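/- Let $N,K\ge 1$, let $\mathcal Y_n\in\mathbb R^{I_1\times\cdots\times I_K\times s_n}$ ($n=1,\dots,N$) be real tensors with $\|\mathcal Y_n\|_F\le B$ for all $n$, where $B>0$, and let $\mathcal K\subseteq\{1,\dots,K\}$ with $|\mathcal K|\ge 2$. Write $\mathcal X\times_1A_1\cdots\times_KA_K$ for the tensor with entries $\sum_{i_1,\dots,i_K}\mathcal X[i_1,\dots,i_K,m]\prod_kA_k[j_k,i_k]$, $\mathcal X_{(k)}$ for the mode-$k$ unfolding, and $P_X=XX^\top$. Let $U_{k,t}\in\mathbb R^{I_k\times g_k}$ (global factors) and $V_{n,k,t}\in\mathbb R^{I_k\times l_{n,k}}$ (local factors), $t=0,1,2,\dots$, be iterates of the following proximal block coordinate descent with parameter $\rho$. The initial factors ($t=0$) and initial local core tensors are arbitrary. In iteration $t$, for $k=1,\dots,K$ in this order: (a) Put $\mathcal R_{G,n}=\mathcal Y_n-\mathcal C_{L,n}\times_1V_{n,1}\cdots\times_KV_{n,K}$, where $V_{n,q}$ are the current local factors ($V_{n,q,t+1}$ for $q<k$, $V_{n,q,t}$ for $q\ge k$) and $\mathcal C_{L,n}=\mathcal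 Y_n\times_1V_{n,1}^\top\cdots\times_KV_{n,K}^\top$ (the initial local core if $t=0$, $k=1$), and $W_{G,n}=(\mathcal R_{G,n})_{(k)}\bigotimes_{q\ne k}U_q$, where $U_q$ are the current global factors and the Kronecker product has the identity in the sample mode. The columns of $U_{k,t+1}$ are orthonormal eigenvectors for the $g_k$ largest eigenvalues of $\sum_nW_{G,n}W_{G,n}^\top+2\rho P_{U_{k,t}}$. (b) For each $n$, put $\mathcal R_{L,n}=\mathcal Y_n-\mathcal C_{G,n}\times_1U_1\cdots\times_KU_K$ with $\mathcal C_{G,n}=\mathcal Y_n\times_1U_1^\top\cdots\times_KU_K^\top$ for the current global factors (now including $U_{k,t+1}$), $W_{L,n}=(\mathcal R_{L,n})_{(k)}\bigotimes_{q\ne k}V_{n,q}$, and $S=W_{L,n}W_{L,n}^\top+2\rho P_{V_{n,k,t}}$. If $k\notin\mathcal K$, the columns of $V_{n,k,t+1}$ are orthonormal eigenvectors for the $l_{n,k}$ largest eigenvalues of $S$. If $k\in\mathcal K$, they are orthonormal eigenvectors for the $l_{n,k}$ largest eigenvalues of $(I-P_{U_{k,t+1}})S(I-P_{U_{k,t+1}})$,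 chosen orthogonal to the columns of $U_{k,t+1}$. If $\rho\ge 8B^2N$, then there is a constant $C>0$ that depends only on $N$ and $K$ such that for every $T\ge 1$ $$\min_{t=1,\dots,T}\sum_{k=1}^K\|U_{k,t+1}U_{k,t+1}^\top-U_{k,t}U_{k,t}^\top\|_F^2\le\frac{C}{T},\qquad \min_{t=1,\dots,T}\sum_{n=1}^N\sum_{k=1}^K\|V_{n,k,t+1}V_{n,k,t+1}^\top-V_{n,k,t}V_{n,k,t}^\top\|_F^2\le\frac{C}{\sqrt T}.$$ -/

import Mathlib

open scoped Matrix Matrix.Norms.Frobenius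

namespace PerTucker

noncomputable section

/-- Real tensors of shape `I 0 × ⋯ × I (K-1) × s`; the last mode indexes the samples of a source.
The norm of this Euclidean space is the Frobenius norm of the tensor. -/
abbrev Tensor {K : ℕ} (I : Fin K → ℕ) (s : ℕ) : Type :=
  EuclideanSpace ℝ ((∀ k, Fin (I k)) × Fin s)

/-- A family with one factor matrix for each mode, of shape `I k × r k`. -/
abbrev Factors {K : ℕ} (I r : Fin K → ℕ) : Type :=
  ∀ k, Matrix (Fin (I k)) (Fin (r k)) ℝ

variable {K : ℕ}

/-- The product `X ×₁ A₁ ×₂ ⋯ ×_K A_K` over all modes except the sample mode: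
`[j₁,…,j_K,m] ↦ ∑_{i₁,…,i_K} X[i₁,…,i_K,m] A₁[j₁,i₁] ⋯ A_K[j_K,i_K]`. -/
def tuckerProd {I J : Fin K → ℕ} {s : ℕ} (X : Tensor I s)
    (A : ∀ k, Matrix (Fin (J k)) (Fin (I k)) ℝ) : Tensor J s :=
  WithLp.toLp 2 fun p => ∑ i : ∀ k, Fin (I k), X (i, p.2) * ∏ k, A k (p.1 k) (i k)

/-- The optimal core tensor `Y ×₁ A₁ᵀ ⋯ ×_K A_Kᵀ` for the factor matrices `A`. -/
def core {I r : Fin K → ℕ} {s : ℕ} (Y : Tensor I s) (A : Factors I r) : Tensor r s :=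
  tuckerProd Y fun k => (A k)ᵀ

/-- The unfolding of a tensor along mode `k`. Its columns are indexed by the positions in all the
other modes (including the sample mode). -/
def unfold {I : Fin K → ℕ} {s : ℕ} (k : Fin K) (X : Tensor I s) :
    Matrix (Fin (I k)) ((∀ q : {q // q ≠ k}, Fin (I q)) × Fin s) ℝ :=
  Matrix.of fun i c => X ((Equiv.piSplitAt k fun q => Fin (I q)).symm (i, c.1), c.2)

/-- The Kronecker product of the factor matrices of all modes `q ≠ k`, with the identity matrix
in the sample mode. -/
def kronExcept {I r : Fin K → ℕ} (s : ℕ) (k : Fin K) (A : Factors I r) :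
    Matrix ((∀ q : {q // q ≠ k}, Fin (I q)) × Fin s)
      ((∀ q : {q // q ≠ k}, Fin (r q)) × Fin s) ℝ :=
  Matrix.of fun x y => (∏ q : {q // q ≠ k}, A q (x.1 q) (y.1 q)) * if x.2 = y.2 then 1 else 0

/-- The matrix `W = R_(k) (⨂_{q ≠ k} A_q)`. -/
def W {I r : Fin K → ℕ} {s : ℕ} (k : Fin K) (R : Tensor I s) (A : Factors I r) :
    Matrix (Fin (I k)) ((∀ q : {q // q ≠ k}, Fin (r q)) × Fin s) ℝ :=
  unfold k R * kronExcept s k A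

/-- The columns of `X` are orthonormal eigenvectors of the (symmetric) matrix `M` that correspond
to its `r` largest eigenvalues, counted with multiplicity: no eigenvector orthogonal to the columns
of `X` has an eigenvalue larger than one of those selected. -/
def IsTopEigenvectors {a r : ℕ} (M : Matrix (Fin a) (Fin a) ℝ) (X : Matrix (Fin a) (Fin r) ℝ) :
    Prop :=
  Xᵀ * X = 1 ∧ ∃ d : Fin r → ℝ, M * X = X * Matrix.diagonal d ∧
    ∀ (x : Fin a → ℝ) (μ : ℝ), x ≠ 0 → Xᵀ *ᵥ x = 0 → M *ᵥ x = μ • x → ∀ j, μ ≤ d j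

/-- The current factors during iteration `t` when mode `k` is about to be updated: the modes before
`k` have index `t + 1`, the others `t`. -/
def curr {I r : Fin K → ℕ} (A : ℕ → Factors I r) (t : ℕ) (k : Fin K) : Factors I r :=
  fun q => if q < k then A (t + 1) q else A t q

/-- The current factors during iteration `t` just after mode `k` has been updated: the modes up to
`k` have index `t + 1`, the others `t`. -/
def next {I r : Fin K → ℕ} (A : ℕ → Factors I r) (t : ℕ) (k : Fin K) : Factors I r :=
  fun q => if q ≤ k then A (t + 1) q else A t q

/-- The local core tensor of a source at the time when the global factor of mode `k` is updated in
iteration `t`: the initial one at the very first step, and afterwards the optimal one for the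
current local factors. -/
def localCore {I r : Fin K → ℕ} {s : ℕ} (Y : Tensor I s) (C₀ : Tensor r s)
    (V : ℕ → Factors I r) (t : ℕ) (k : Fin K) : Tensor r s :=
  if t = 0 ∧ (k : ℕ) = 0 then C₀ else core Y (curr V t k)

/-- The global residual `R_G` of a source when mode `k` is updated in iteration `t`. -/
def globalResidual {I r : Fin K → ℕ} {s : ℕ} (Y : Tensor I s) (C₀ : Tensor r s)
    (V : ℕ → Factors I r) (t : ℕ) (k : Fin K) : Tensor I s :=
  Y - tuckerProd (localCore Y C₀ V t k) (curr V t k)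

/-- The local residual `R_L` of a source when mode `k` is updated in iteration `t`, after the
update of the global factor of mode `k`. -/
def localResidual {I g : Fin K → ℕ} {s : ℕ} (Y : Tensor I s)
    (U : ℕ → Factors I g) (t : ℕ) (k : Fin K) : Tensor I s :=
  Y - tuckerProd (core Y (next U t k)) (next U t k)

variable {N : ℕ} {I g : Fin K → ℕ} {s : Fin N → ℕ} {l : Fin N → Fin K → ℕ}

/-- The matrix `∑ₙ W_{G,n} W_{G,n}ᵀ + 2ρ U_{k,t} U_{k,t}ᵀ`. -/
def globalMatrix (Y : ∀ n, Tensor I (s n)) (ρ : ℝ) (C₀ : ∀ n, Tensor (l n) (s n))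
    (U : ℕ → Factors I g) (V : ∀ n, ℕ → Factors I (l n)) (t : ℕ) (k : Fin K) :
    Matrix (Fin (I k)) (Fin (I k)) ℝ :=
  ∑ n, W k (globalResidual (Y n) (C₀ n) (V n) t k) (curr U t k) *
      (W k (globalResidual (Y n) (C₀ n) (V n) t k) (curr U t k))ᵀ
    + (2 * ρ) • (U t k * (U t k)ᵀ)

/-- The matrix `W_{L,n} W_{L,n}ᵀ + 2ρ V_{n,k,t} V_{n,k,t}ᵀ` of the source `n`. -/
def localMatrix (Y : ∀ n, Tensor I (s n)) (ρ : ℝ)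
    (U : ℕ → Factors I g) (V : ∀ n, ℕ → Factors I (l n)) (t : ℕ) (n : Fin N) (k : Fin K) :
    Matrix (Fin (I k)) (Fin (I k)) ℝ :=
  W k (localResidual (Y n) U t k) (curr (V n) t k) *
      (W k (localResidual (Y n) U t k) (curr (V n) t k))ᵀ
    + (2 * ρ) • (V n t k * (V n t k)ᵀ)

/-- `U`, `V` are the iterates of proximal block coordinate descent for the data `Y` with proximal
parameter `ρ` and set `𝒦` of orthogonal modes. The initial factors `U 0`, `V n 0` and the initial
local cores `C₀` are arbitrary; in each iteration the modes are visited in increasing order, and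
for each of them first the global factor and then the local factors of all sources are updated. -/
structure IsRun (𝒦 : Finset (Fin K)) (Y : ∀ n, Tensor I (s n)) (ρ : ℝ)
    (C₀ : ∀ n, Tensor (l n) (s n)) (U : ℕ → Factors I g) (V : ∀ n, ℕ → Factors I (l n)) :
    Prop where
  global_update : ∀ t k, IsTopEigenvectors (globalMatrix Y ρ C₀ U V t k) (U (t + 1) k)
  local_update_of_notMem : ∀ t n k, k ∉ 𝒦 →
    IsTopEigenvectors (localMatrix Y ρ U V t n k) (V n (t + 1) k)
  /- The orthogonality to the new global factor only matters when the projected matrix has fewer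
  positive eigenvalues than columns are needed: eigenvectors for a positive eigenvalue have it. -/
  local_update_of_mem : ∀ t n k, k ∈ 𝒦 →
    IsTopEigenvectors
        ((1 - U (t + 1) k * (U (t + 1) k)ᵀ) * localMatrix Y ρ U V t n k *
          (1 - U (t + 1) k * (U (t + 1) k)ᵀ))
        (V n (t + 1) k) ∧
      (U (t + 1) k)ᵀ * V n (t + 1) k = 0

/-- `∑ₖ ‖U_{k,t+1} U_{k,t+1}ᵀ − U_{k,t} U_{k,t}ᵀ‖_F²`, the change of the spanned subspaces in
iteration `t`. -/
def subspaceChange {r : Fin K → ℕ} (A : ℕ → Factors I r) (t : ℕ) : ℝ :=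
  ∑ k, ‖A (t + 1) k * (A (t + 1) k)ᵀ - A t k * (A t k)ᵀ‖ ^ 2

end

end PerTucker

/-! Orthogonality decouples the two blocks. For `t ≥ 1` the global and local factors are orthogonal
in every mode of `𝒦`. Since `𝒦` has two modes, one of them, `q ≠ k`, stays orthogonal while mode `k`
changes, and it annihilates the part that the residual subtracts (`core_sub_tuckerProd`). Hence `‖Xᵀ
W‖` is the norm of the core of `Y` itself with `X` put in mode `k`, and the two blocks climb the
separate objectives `∑ ‖core Y U‖²` and `‖core Y V‖²`.

Top eigenvectors maximize the compressed trace (`IsTopEigenvectors.trace_le`), so the proximal term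
makes each global update raise its objective by at least `ρ` times the squared change of the
projection. The objective lies in `[0, N B²]`; telescoping bounds the sum of all squared changes by
`N B² / ρ ≤ 1/8`, which gives the rate `1/T`.

In a mode of `𝒦` the old local factor need not be orthogonal to the new global one. Projecting it
costs an error linear in the change `‖D‖` of the global projection, plus a quadratic one
(`IsTopEigenvectors.projected_proximal_le`). By Cauchy–Schwarz the linear errors sum to order `√T`,
so the local rate is only `1/√T`. -/

namespace PerTucker

/-! ### Frobenius norms, traces and orthogonal projections -/

section Frobenius

variable {m n p r : Type*} [Fintype m] [Fintype n] [Fintype p] [Fintype r]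

theorem frobenius_norm_sq_eq_sum (A : Matrix m n ℝ) : ‖A‖ ^ 2 = ∑ i, ∑ j, A i j ^ 2 := by
  have h : 0 ≤ ∑ i, ∑ j, A i j ^ 2 :=
    Finset.sum_nonneg fun i _ => Finset.sum_nonneg fun j _ => sq_nonneg _
  rw [Matrix.frobenius_norm_def]
  simp only [Real.rpow_two, Real.norm_eq_abs, sq_abs]
  rw [← Real.sqrt_eq_rpow, Real.sq_sqrt h]

theorem frobenius_norm_sq_eq_trace (A : Matrix m n ℝ) : ‖A‖ ^ 2 = (Aᵀ * A).trace := by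
  rw [frobenius_norm_sq_eq_sum, Finset.sum_comm]
  simp [Matrix.trace, Matrix.mul_apply, sq]

theorem frobenius_norm_sq_transpose_mul (A : Matrix m n ℝ) (X : Matrix m r ℝ) :
    ‖Xᵀ * A‖ ^ 2 = (Xᵀ * (A * Aᵀ) * X).trace := by
  rw [← Matrix.frobenius_norm_transpose, frobenius_norm_sq_eq_trace]
  simp [Matrix.mul_assoc]

theorem frobenius_norm_sq_sub (A B : Matrix m n ℝ) :
    ‖A - B‖ ^ 2 = ‖A‖ ^ 2 - 2 * (Aᵀ * B).trace + ‖B‖ ^ 2 := by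
  simp only [frobenius_norm_sq_eq_sum, Matrix.trace, Matrix.diag, Matrix.mul_apply,
    Matrix.transpose_apply, Matrix.sub_apply]
  rw [Finset.sum_comm (s := (Finset.univ : Finset n)), Finset.mul_sum,
    ← Finset.sum_sub_distrib, ← Finset.sum_add_distrib]
  refine Finset.sum_congr rfl fun i _ => ?_
  rw [Finset.mul_sum, ← Finset.sum_sub_distrib, ← Finset.sum_add_distrib]
  exact Finset.sum_congr rfl fun j _ => by ring

theorem trace_transpose_mul_le (A B : Matrix m n ℝ) : (Aᵀ * B).trace ≤ ‖A‖ * ‖B‖ := by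
  have h := frobenius_norm_sq_sub A B
  have h' : ‖A‖ - ‖B‖ ≤ ‖A - B‖ := norm_sub_norm_le A B
  have h'' : ‖B‖ - ‖A‖ ≤ ‖A - B‖ := by rw [norm_sub_rev]; exact norm_sub_norm_le B A
  nlinarith [norm_nonneg (A - B), abs_le.mpr ⟨by linarith, h'⟩, sq_abs (‖A‖ - ‖B‖),
    sq_le_sq' (by linarith : -‖A - B‖ ≤ ‖A‖ - ‖B‖) h']

/-- Pythagoras: `A * X * Xᵀ` projects the rows of `A` orthogonally, and its norm is that of `A * X`.
-/
theorem frobenius_norm_mul_le_of_orthonormal [DecidableEq r] (A : Matrix m n ℝ) {X : Matrix n r ℝ}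
    (hX : Xᵀ * X = 1) : ‖A * X‖ ≤ ‖A‖ := by
  have h : ‖A - A * X * Xᵀ‖ ^ 2 = ‖A‖ ^ 2 - ‖A * X‖ ^ 2 := by
    have h1 : (Aᵀ * (A * X * Xᵀ)).trace = ‖A * X‖ ^ 2 := by
      rw [frobenius_norm_sq_eq_trace, Matrix.transpose_mul, Matrix.mul_assoc Xᵀ,
        Matrix.trace_mul_comm Xᵀ]
      simp only [Matrix.mul_assoc]
    have h2 : ‖A * X * Xᵀ‖ ^ 2 = ‖A * X‖ ^ 2 := by
      rw [← Matrix.frobenius_norm_transpose, frobenius_norm_sq_eq_trace,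
        ← Matrix.frobenius_norm_transpose (A * X), frobenius_norm_sq_eq_trace]
      have : A * (X * (Xᵀ * (X * (Xᵀ * Aᵀ)))) = A * (X * (Xᵀ * Aᵀ)) := by
        rw [← Matrix.mul_assoc Xᵀ X, hX, Matrix.one_mul]
      simp [Matrix.mul_assoc, this]
    rw [frobenius_norm_sq_sub, h1, h2]; ring
  nlinarith [norm_nonneg A, norm_nonneg (A * X), sq_nonneg ‖A - A * X * Xᵀ‖]

theorem frobenius_norm_sq_of_orthonormal [DecidableEq r] {X : Matrix m r ℝ} (hX : Xᵀ * X = 1) :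
    ‖X‖ ^ 2 = Fintype.card r := by
  rw [frobenius_norm_sq_eq_trace, hX, Matrix.trace_one]

theorem frobenius_norm_sq_mul_transpose [DecidableEq r] {X : Matrix m r ℝ} (hX : Xᵀ * X = 1) :
    ‖X * Xᵀ‖ ^ 2 = Fintype.card r := by
  have : X * (Xᵀ * (X * Xᵀ)) = X * Xᵀ := by
    rw [← Matrix.mul_assoc Xᵀ X, hX, Matrix.one_mul]
  rw [frobenius_norm_sq_eq_trace, ← frobenius_norm_sq_of_orthonormal hX,
    frobenius_norm_sq_eq_trace, Matrix.trace_mul_comm Xᵀ X]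
  simp [Matrix.mul_assoc, this]

/-- Converts the proximal reward `‖Xᵀ * V‖²` into a distance between subspaces. -/
theorem frobenius_norm_sq_projection_sub [DecidableEq r] {X V : Matrix m r ℝ} (hX : Xᵀ * X = 1)
    (hV : Vᵀ * V = 1) :
    ‖X * Xᵀ - V * Vᵀ‖ ^ 2 = 2 * (Fintype.card r : ℝ) - 2 * ‖Xᵀ * V‖ ^ 2 := by
  rw [frobenius_norm_sq_sub, frobenius_norm_sq_mul_transpose hX, frobenius_norm_sq_mul_transpose hV,
    frobenius_norm_sq_transpose_mul, Matrix.transpose_mul, Matrix.transpose_transpose,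
    Matrix.mul_assoc X, Matrix.trace_mul_comm X]
  ring

end Frobenius

/-! ### Variational characterization of top eigenvectors -/

/-- A symmetric matrix whose eigenvectors for positive eigenvalues do not exist is negative
semidefinite. -/
theorem posSemidef_neg_of_eigenvalue_nonpos {a : ℕ} {M : Matrix (Fin a) (Fin a) ℝ} (hM : Mᵀ = M)
    (h : ∀ (x : Fin a → ℝ) (μ : ℝ), x ≠ 0 → M *ᵥ x = μ • x → μ ≤ 0) : (-M).PosSemidef := by
  have hH : (-M).IsHermitian := by
    rw [Matrix.IsHermitian, Matrix.conjTranspose_eq_transpose_of_trivial, Matrix.transpose_neg, hM]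
  rw [hH.posSemidef_iff_eigenvalues_nonneg]
  intro i
  have hv := hH.mulVec_eigenvectorBasis i
  have hne : (hH.eigenvectorBasis i).ofLp ≠ 0 := fun h0 =>
    hH.eigenvectorBasis.toBasis.ne_zero i (by simpa using h0)
  have := h _ (-(hH.eigenvalues i)) hne (by
    rw [Matrix.neg_mulVec] at hv
    rw [neg_smul, ← hv, neg_neg])
  simpa using this

/-- The subspace spanned by the top eigenvectors maximizes the trace of the compression. -/
theorem IsTopEigenvectors.trace_le {a r : ℕ} {M : Matrix (Fin a) (Fin a) ℝ}
    {X Z : Matrix (Fin a) (Fin r) ℝ} (hX : IsTopEigenvectors M X) (hM : Mᵀ = M)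
    (hZ : Zᵀ * Z = 1) : (Zᵀ * M * Z).trace ≤ (Xᵀ * M * X).trace := by
  obtain ⟨hXX, d, hd, htop⟩ := hX
  rcases Nat.eq_zero_or_pos r with rfl | hr
  · simp [Matrix.trace]
  have : Nonempty (Fin r) := ⟨⟨0, hr⟩⟩
  obtain ⟨j₀, hj₀⟩ := Finite.exists_min d
  set c := d j₀ with hc
  set E : Matrix (Fin r) (Fin r) ℝ := Matrix.diagonal fun j => d j - c with hE
  have hdX : Xᵀ * M = Matrix.diagonal d * Xᵀ := by
    have := congrArg Matrix.transpose hd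
    simpa [Matrix.transpose_mul, hM] using this
  have hXMX : Xᵀ * M * X = Matrix.diagonal d := by
    rw [hdX, Matrix.mul_assoc, hXX, Matrix.mul_one]
  have hEd : E = Matrix.diagonal d - c • (1 : Matrix (Fin r) (Fin r) ℝ) := by
    ext i j; by_cases hij : i = j <;> simp [hE, hij]
  -- With `c` the least selected eigenvalue, `L` is `M - c` with its part on the span of `X`
  -- removed. An eigenvector of `L` with positive eigenvalue would be orthogonal to `X` and belong
  -- to an eigenvalue of `M` above `c`, so `L` is negative semidefinite.
  set L : Matrix (Fin a) (Fin a) ℝ := M - c • 1 - X * E * Xᵀ with hL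
  have hLT : Lᵀ = L := by
    simp [hL, hM, Matrix.transpose_mul, hE, Matrix.mul_assoc]
  have hXL : Xᵀ * L = 0 := by
    rw [hL, Matrix.mul_sub, Matrix.mul_sub, hdX, Matrix.mul_assoc X, ← Matrix.mul_assoc Xᵀ, hXX,
      hEd, Matrix.sub_mul]
    simp
  have hneg : (-L).PosSemidef := by
    refine posSemidef_neg_of_eigenvalue_nonpos hLT fun x μ hx hμ => ?_
    by_contra! hpos
    have hXx : Xᵀ *ᵥ x = 0 := by
      have h1 : Xᵀ *ᵥ (L *ᵥ x) = 0 := by rw [Matrix.mulVec_mulVec, hXL, Matrix.zero_mulVec]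
      rw [hμ, Matrix.mulVec_smul] at h1
      exact (smul_eq_zero.mp h1).resolve_left hpos.ne'
    have h2 : M *ᵥ x = (μ + c) • x := by
      have h3 : (X * E * Xᵀ) *ᵥ x = 0 := by
        rw [← Matrix.mulVec_mulVec, hXx, Matrix.mulVec_zero]
      rw [hL, Matrix.sub_mulVec, Matrix.sub_mulVec, h3, Matrix.smul_mulVec, Matrix.one_mulVec,
        sub_zero, sub_eq_iff_eq_add] at hμ
      rw [hμ, add_smul]
    have := htop x _ hx hXx h2 j₀
    linarith
  have h1 : (Zᵀ * L * Z).trace ≤ 0 := by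
    have h := (hneg.conjTranspose_mul_mul_same Z).trace_nonneg
    rw [Matrix.conjTranspose_eq_transpose_of_trivial, Matrix.mul_neg, Matrix.neg_mul,
      Matrix.trace_neg] at h
    linarith
  have h2 : (Zᵀ * (X * E * Xᵀ) * Z).trace ≤ ∑ j, (d j - c) := by
    have hrw : (Zᵀ * (X * E * Xᵀ) * Z).trace = ∑ j, (d j - c) * (Xᵀ * (Z * Zᵀ) * X) j j := by
      have : Zᵀ * (X * E * Xᵀ) * Z = (Zᵀ * X) * (E * (Xᵀ * Z)) := by
        simp only [Matrix.mul_assoc]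
      rw [this, Matrix.trace_mul_comm]
      have : E * (Xᵀ * Z) * (Zᵀ * X) = E * (Xᵀ * (Z * Zᵀ) * X) := by
        simp only [Matrix.mul_assoc]
      rw [this, hE]
      simp [Matrix.trace, Matrix.diagonal_mul]
    rw [hrw]
    refine Finset.sum_le_sum fun j _ => mul_le_of_le_one_right (sub_nonneg.mpr (hj₀ j)) ?_
    -- The Gram matrix of the components of the columns of `X` orthogonal to `Z` has nonnegative
    -- diagonal, so each weight is at most 1.
    have hps : ((X - Z * (Zᵀ * X))ᵀ * (X - Z * (Zᵀ * X))) = 1 - Xᵀ * (Z * Zᵀ) * X := by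
      have : Zᵀ * (Z * (Zᵀ * X)) = Zᵀ * X := by rw [← Matrix.mul_assoc, hZ, Matrix.one_mul]
      simp [Matrix.sub_mul, Matrix.mul_sub, Matrix.mul_assoc, hXX, this]
    have hj := congrFun (congrFun hps j) j
    have hnn : 0 ≤ ((X - Z * (Zᵀ * X))ᵀ * (X - Z * (Zᵀ * X))) j j := by
      rw [Matrix.mul_apply]
      exact Finset.sum_nonneg fun i _ => by simpa using mul_self_nonneg _
    rw [hj, Matrix.sub_apply, Matrix.one_apply_eq] at hnn
    linarith
  have hM' : Zᵀ * M * Z = Zᵀ * L * Z + Zᵀ * (X * E * Xᵀ) * Z + c • 1 := by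
    have : M = L + X * E * Xᵀ + c • 1 := by rw [hL]; abel
    conv_lhs => rw [this]
    simp [Matrix.mul_add, Matrix.add_mul, hZ]
  rw [hM', hXMX, Matrix.trace_add, Matrix.trace_add, Matrix.trace_diagonal]
  have h3 : (c • (1 : Matrix (Fin r) (Fin r) ℝ)).trace = ∑ _j : Fin r, c := by
    simp [Matrix.trace_smul, mul_comm]
  rw [h3]
  rw [Finset.sum_sub_distrib] at h2
  linarith

/-! ### Tucker products, cores and unfoldings -/

variable {K : ℕ}

theorem prod_eq_mul_prod_subtype_ne (k : Fin K) (f : Fin K → ℝ) :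
    ∏ q, f q = f k * ∏ q : {q // q ≠ k}, f q := by
  rw [Fintype.prod_eq_mul_prod_compl k f]
  congr 1
  exact Finset.prod_subtype _ (by simp) _

theorem sum_eq_sum_piSplitAt {I : Fin K → ℕ} (k : Fin K) (f : (∀ q, Fin (I q)) → ℝ) :
    ∑ i, f i = ∑ a, ∑ b, f ((Equiv.piSplitAt k fun q => Fin (I q)).symm (a, b)) := by
  rw [← (Equiv.piSplitAt k fun q => Fin (I q)).symm.sum_comp, Fintype.sum_prod_type]

theorem norm_unfold {I : Fin K → ℕ} {s : ℕ} (k : Fin K) (X : Tensor I s) :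
    ‖unfold k X‖ = ‖X‖ := by
  have h : ‖unfold k X‖ ^ 2 = ‖X‖ ^ 2 := by
    rw [frobenius_norm_sq_eq_sum, EuclideanSpace.norm_sq_eq]
    simp only [unfold, Matrix.of_apply, Fintype.sum_prod_type, Real.norm_eq_abs, sq_abs]
    rw [sum_eq_sum_piSplitAt k]
  exact (sq_eq_sq₀ (norm_nonneg _) (norm_nonneg _)).mp h

theorem tuckerProd_sub {I J : Fin K → ℕ} {s : ℕ} (X X' : Tensor I s)
    (A : ∀ k, Matrix (Fin (J k)) (Fin (I k)) ℝ) :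
    tuckerProd (X - X') A = tuckerProd X A - tuckerProd X' A := by
  ext p
  simp [tuckerProd, sub_mul]

theorem tuckerProd_tuckerProd {I J L : Fin K → ℕ} {s : ℕ} (X : Tensor I s)
    (A : ∀ k, Matrix (Fin (J k)) (Fin (I k)) ℝ) (B : ∀ k, Matrix (Fin (L k)) (Fin (J k)) ℝ) :
    tuckerProd (tuckerProd X A) B = tuckerProd X fun k => B k * A k := by
  ext p
  simp only [tuckerProd, Matrix.mul_apply, Finset.sum_mul]
  rw [Finset.sum_comm]
  refine Finset.sum_congr rfl fun i _ => ?_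
  rw [Finset.prod_univ_sum, Fintype.piFinset_univ, Finset.mul_sum]
  refine Finset.sum_congr rfl fun j _ => ?_
  rw [Finset.prod_mul_distrib]
  ring

theorem tuckerProd_eq_zero {I J : Fin K → ℕ} {s : ℕ} (X : Tensor I s)
    {A : ∀ k, Matrix (Fin (J k)) (Fin (I k)) ℝ} {q : Fin K} (hq : A q = 0) :
    tuckerProd X A = 0 := by
  ext p
  simp only [tuckerProd, PiLp.zero_apply]
  exact Finset.sum_eq_zero fun i _ => by
    rw [Finset.prod_eq_zero (Finset.mem_univ q) (by simp [hq]), mul_zero]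

theorem tuckerProd_one {I : Fin K → ℕ} {s : ℕ} (X : Tensor I s) :
    tuckerProd X (fun _ => 1) = X := by
  ext p
  simp only [tuckerProd, Matrix.one_apply]
  rw [Finset.sum_eq_single p.1]
  · simp
  · intro i _ hi
    obtain ⟨q, hq⟩ := Function.ne_iff.mp hi
    rw [Finset.prod_eq_zero (Finset.mem_univ q) (by simp [Ne.symm hq]), mul_zero]
  · simp

theorem inner_tuckerProd {I J : Fin K → ℕ} {s : ℕ} (X : Tensor I s) (Z : Tensor J s)
    (A : ∀ k, Matrix (Fin (J k)) (Fin (I k)) ℝ) :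
    inner ℝ (tuckerProd X A) Z = inner ℝ X (tuckerProd Z fun k => (A k)ᵀ) := by
  simp only [PiLp.inner_apply, tuckerProd, Fintype.sum_prod_type, RCLike.inner_apply, conj_trivial,
    Finset.mul_sum, Finset.sum_mul, Matrix.transpose_apply]
  rw [Finset.sum_comm]
  rw [Finset.sum_comm (s := (Finset.univ : Finset (∀ k, Fin (I k))))]
  refine Finset.sum_congr rfl fun m _ => ?_
  rw [Finset.sum_comm]
  exact Finset.sum_congr rfl fun i _ => Finset.sum_congr rfl fun j _ => by ring

theorem core_tuckerProd {I r r' : Fin K → ℕ} {s : ℕ} (X : Tensor r' s) (A : Factors I r)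
    (B : Factors I r') : core (tuckerProd X B) A = tuckerProd X fun k => (A k)ᵀ * B k :=
  tuckerProd_tuckerProd X B _

/-- The part of a residual explained by orthogonal factors does not contribute to the core. -/
theorem core_sub_tuckerProd {I r r' : Fin K → ℕ} {s : ℕ} (Y : Tensor I s) (X : Tensor r' s)
    (A : Factors I r) (B : Factors I r') {q : Fin K} (hq : (A q)ᵀ * B q = 0) :
    core (Y - tuckerProd X B) A = core Y A := by
  have h := core_tuckerProd X A B
  rw [tuckerProd_eq_zero (A := fun k => (A k)ᵀ * B k) X hq] at h
  rw [core, tuckerProd_sub, ← core, ← core, h, sub_zero]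

theorem norm_tuckerProd_of_orthonormal {I r : Fin K → ℕ} {s : ℕ} (X : Tensor r s) {A : Factors I r}
    (hA : ∀ k, (A k)ᵀ * A k = 1) : ‖tuckerProd X A‖ ^ 2 = ‖X‖ ^ 2 := by
  rw [← real_inner_self_eq_norm_sq, inner_tuckerProd, tuckerProd_tuckerProd]
  simp only [hA]
  rw [tuckerProd_one, real_inner_self_eq_norm_sq]

/-- Pythagoras for the orthogonal projection of `Y` onto the tensors generated by `A`. -/
theorem norm_sub_tuckerProd_core {I r : Fin K → ℕ} {s : ℕ} (Y : Tensor I s) {A : Factors I r}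
    (hA : ∀ k, (A k)ᵀ * A k = 1) :
    ‖Y - tuckerProd (core Y A) A‖ ^ 2 = ‖Y‖ ^ 2 - ‖core Y A‖ ^ 2 := by
  rw [norm_sub_sq_real, norm_tuckerProd_of_orthonormal _ hA, real_inner_comm, inner_tuckerProd]
  change ‖Y‖ ^ 2 - 2 * inner ℝ (core Y A) (core Y A) + _ = _
  rw [real_inner_self_eq_norm_sq]
  ring

theorem norm_sub_tuckerProd_core_le {I r : Fin K → ℕ} {s : ℕ} (Y : Tensor I s) {A : Factors I r}
    (hA : ∀ k, (A k)ᵀ * A k = 1) : ‖Y - tuckerProd (core Y A) A‖ ≤ ‖Y‖ :=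
  (sq_le_sq₀ (norm_nonneg _) (norm_nonneg _)).mp
    (by rw [norm_sub_tuckerProd_core Y hA]; linarith [sq_nonneg ‖core Y A‖])

theorem norm_core_le {I r : Fin K → ℕ} {s : ℕ} (Y : Tensor I s) {A : Factors I r}
    (hA : ∀ k, (A k)ᵀ * A k = 1) : ‖core Y A‖ ≤ ‖Y‖ :=
  (sq_le_sq₀ (norm_nonneg _) (norm_nonneg _)).mp
    (by linarith [norm_sub_tuckerProd_core Y hA, sq_nonneg ‖Y - tuckerProd (core Y A) A‖])

theorem kronExcept_transpose_mul_self {I r : Fin K → ℕ} (s : ℕ) (k : Fin K) {A : Factors I r}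
    (hA : ∀ k, (A k)ᵀ * A k = 1) : (kronExcept s k A)ᵀ * kronExcept s k A = 1 := by
  ext y z
  have hprod : ∑ x : ∀ q : {q // q ≠ k}, Fin (I q),
      (∏ q : {q // q ≠ k}, A q (x q) (y.1 q)) * ∏ q : {q // q ≠ k}, A q (x q) (z.1 q) =
      if y.1 = z.1 then 1 else 0 := by
    have h : ∀ q : {q // q ≠ k}, ∑ i, A q i (y.1 q) * A q i (z.1 q) =
        if y.1 q = z.1 q then 1 else 0 := fun q => by
      have := congrFun (congrFun (hA q) (y.1 q)) (z.1 q)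
      rwa [Matrix.mul_apply, Matrix.one_apply] at this
    simp only [← Finset.prod_mul_distrib]
    rw [← Fintype.piFinset_univ,
      ← Finset.prod_univ_sum (fun q : {q // q ≠ k} => (Finset.univ : Finset (Fin (I q))))
        (fun q i => A q i (y.1 q) * A q i (z.1 q))]
    simp only [h, Finset.prod_ite_zero, funext_iff]
    simp
  rw [Matrix.mul_apply, Fintype.sum_prod_type]
  have : ∀ (x : ∀ q : {q // q ≠ k}, Fin (I q)), ∑ m : Fin s,
      (kronExcept s k A)ᵀ y (x, m) * kronExcept s k A (x, m) z =
      ((∏ q : {q // q ≠ k}, A q (x q) (y.1 q)) * ∏ q : {q // q ≠ k}, A q (x q) (z.1 q)) *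
        if y.2 = z.2 then 1 else 0 := by
    intro x
    rw [Finset.sum_eq_single y.2]
    · simp [kronExcept]
    · intro m _ hm
      simp [kronExcept, hm]
    · simp
  simp only [this]
  rw [← Finset.sum_mul, hprod, Matrix.one_apply]
  by_cases h1 : y.1 = z.1 <;> by_cases h2 : y.2 = z.2 <;> simp [h1, h2, Prod.ext_iff]

theorem norm_W_le {I r : Fin K → ℕ} {s : ℕ} (k : Fin K) (R : Tensor I s) {A : Factors I r}
    (hA : ∀ k, (A k)ᵀ * A k = 1) : ‖W k R A‖ ≤ ‖R‖ := by
  rw [← norm_unfold k R]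
  exact frobenius_norm_mul_le_of_orthonormal _ (kronExcept_transpose_mul_self s k hA)

/-- Links the matrix eigenproblem of mode `k` to the tensor objective: the product with `Xᵀ`
supplies the one mode missing from the Kronecker product. -/
theorem transpose_mul_W {I r : Fin K → ℕ} {s : ℕ} (k : Fin K) (R : Tensor I s) (A : Factors I r)
    (X : Matrix (Fin (I k)) (Fin (r k)) ℝ) :
    Xᵀ * W k R A = unfold k (core R (Function.update A k X)) := by
  ext a y
  simp only [W, unfold, core, tuckerProd, Matrix.mul_apply, Matrix.of_apply, Matrix.transpose_apply,
    kronExcept, Fintype.sum_prod_type]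
  rw [sum_eq_sum_piSplitAt k]
  refine Finset.sum_congr rfl fun i _ => ?_
  rw [Finset.mul_sum]
  refine Finset.sum_congr rfl fun c _ => ?_
  rw [Finset.sum_eq_single y.2 (fun m _ hm => by simp [hm]) (by simp),
    prod_eq_mul_prod_subtype_ne k]
  have h : ∀ q : {q // q ≠ k}, Function.update A k X q
      ((Equiv.piSplitAt k fun q => Fin (I q)).symm (i, c) q)
      ((Equiv.piSplitAt k fun q => Fin (r q)).symm (a, y.1) q) = A q (c q) (y.1 q) := fun q => by
    simp [Equiv.piSplitAt, q.2]
  simp only [h]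
  simp [Equiv.piSplitAt]
  ring

theorem norm_transpose_mul_W {I r : Fin K → ℕ} {s : ℕ} (k : Fin K) (R : Tensor I s)
    (A : Factors I r) (X : Matrix (Fin (I k)) (Fin (r k)) ℝ) :
    ‖Xᵀ * W k R A‖ = ‖core R (Function.update A k X)‖ := by
  rw [transpose_mul_W, norm_unfold]

/-! ### Gain of a single proximal update -/

theorem trace_proximal {m r r' : Type*} [Fintype m] [Fintype r] [Fintype r']
    (M : Matrix m m ℝ) (V : Matrix m r' ℝ) (X : Matrix m r ℝ) (ρ : ℝ) :
    (Xᵀ * (M + (2 * ρ) • (V * Vᵀ)) * X).trace =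
      (Xᵀ * M * X).trace + 2 * ρ * ‖Xᵀ * V‖ ^ 2 := by
  rw [Matrix.mul_add, Matrix.add_mul, Matrix.trace_add, Matrix.mul_smul, Matrix.smul_mul,
    Matrix.trace_smul, frobenius_norm_sq_transpose_mul, smul_eq_mul]

theorem IsTopEigenvectors.proximal_le {a r : ℕ} {M : Matrix (Fin a) (Fin a) ℝ} {ρ : ℝ}
    {V V' : Matrix (Fin a) (Fin r) ℝ} (hM : Mᵀ = M) (hV : Vᵀ * V = 1)
    (h : IsTopEigenvectors (M + (2 * ρ) • (V * Vᵀ)) V') :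
    ρ * ‖V' * V'ᵀ - V * Vᵀ‖ ^ 2 ≤ (V'ᵀ * M * V').trace - (Vᵀ * M * V).trace := by
  have h1 := h.trace_le (Z := V) (by simp [hM, Matrix.transpose_mul]) hV
  rw [trace_proximal, trace_proximal, hV] at h1
  rw [frobenius_norm_sq_projection_sub h.1 hV]
  have h2 : ‖(1 : Matrix (Fin r) (Fin r) ℝ)‖ ^ 2 = Fintype.card (Fin r) :=
    frobenius_norm_sq_of_orthonormal (by simp)
  rw [h2] at h1
  linarith

theorem IsTopEigenvectors.projected_proximal_le {a r r' : ℕ} {β : Type*} [Fintype β]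
    {A : Matrix (Fin a) β ℝ} {ρ B : ℝ} {V V' : Matrix (Fin a) (Fin r) ℝ}
    {U U' : Matrix (Fin a) (Fin r') ℝ} (hρ : 0 ≤ ρ) (hA : ‖A‖ ≤ B) (hV : Vᵀ * V = 1)
    (hU' : U'ᵀ * U' = 1) (hUV : Uᵀ * V = 0) (hUV' : U'ᵀ * V' = 0)
    (h : IsTopEigenvectors
      ((1 - U' * U'ᵀ) * (A * Aᵀ + (2 * ρ) • (V * Vᵀ)) * (1 - U' * U'ᵀ)) V') :
    ρ * ‖V' * V'ᵀ - V * Vᵀ‖ ^ 2 ≤ ‖V'ᵀ * A‖ ^ 2 - ‖Vᵀ * A‖ ^ 2 +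
      (2 * B ^ 2 * ‖U' * U'ᵀ - U * Uᵀ‖ + 4 * ρ * ‖U' * U'ᵀ - U * Uᵀ‖ ^ 2) := by
  set Q : Matrix (Fin a) (Fin a) ℝ := 1 - U' * U'ᵀ with hQ
  set D := U' * U'ᵀ - U * Uᵀ with hD
  set E := D * V with hE
  have hQT : Qᵀ = Q := by simp [hQ, Matrix.transpose_mul]
  have hQV' : Q * V' = V' := by simp [hQ, Matrix.sub_mul, Matrix.mul_assoc, hUV']
  -- Since `Uᵀ * V = 0`, the component of `V` lost under `Q` is exactly `D * V`, so it is controlled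
  -- by the change of the global projection.
  have hE' : E = U' * (U'ᵀ * V) := by
    simp [hE, hD, Matrix.sub_mul, Matrix.mul_assoc, hUV]
  have hQV : Q * V = V - E := by simp [hQ, hE', Matrix.sub_mul, Matrix.mul_assoc]
  have hEE : Eᵀ * V = Eᵀ * E := by
    have : U'ᵀ * (U' * (U'ᵀ * V)) = U'ᵀ * V := by
      rw [← Matrix.mul_assoc, hU', Matrix.one_mul]
    simp [hE', Matrix.transpose_mul, Matrix.mul_assoc, this]
  have hED : ‖E‖ ≤ ‖D‖ := frobenius_norm_mul_le_of_orthonormal D hV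
  have hcomp : ∀ X : Matrix (Fin a) (Fin r) ℝ,
      (Xᵀ * (Q * (A * Aᵀ + (2 * ρ) • (V * Vᵀ)) * Q) * X).trace =
        ‖(Q * X)ᵀ * A‖ ^ 2 + 2 * ρ * ‖(Q * X)ᵀ * V‖ ^ 2 := fun X => by
    rw [frobenius_norm_sq_transpose_mul A, ← trace_proximal, Matrix.transpose_mul, hQT]
    simp only [Matrix.mul_assoc]
  have h1 := h.trace_le (Z := V) (by simp [hQT, Matrix.transpose_mul, Matrix.mul_assoc]) hV
  rw [hcomp, hcomp, hQV', hQV, Matrix.transpose_sub, Matrix.sub_mul, Matrix.sub_mul, hV, hEE] at h1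
  have h2 : ‖(1 : Matrix (Fin r) (Fin r) ℝ)‖ ^ 2 = Fintype.card (Fin r) :=
    frobenius_norm_sq_of_orthonormal (by simp)
  -- The proximal term loses only second order in `‖D‖`, because `Eᵀ * V = Eᵀ * E`; the data term in
  -- `h4` loses first order.
  have h3 : (Fintype.card (Fin r) : ℝ) - 2 * ‖D‖ ^ 2 ≤ ‖1 - Eᵀ * E‖ ^ 2 := by
    rw [frobenius_norm_sq_sub 1, h2, Matrix.transpose_one, Matrix.one_mul,
      ← frobenius_norm_sq_eq_trace]
    nlinarith [norm_nonneg E, sq_nonneg ‖Eᵀ * E‖]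
  have hB : 0 ≤ B := (norm_nonneg A).trans hA
  have hVA : ‖Vᵀ * A‖ ≤ B := by
    rw [← Matrix.frobenius_norm_transpose, Matrix.transpose_mul, Matrix.transpose_transpose]
    exact (frobenius_norm_mul_le_of_orthonormal _ hV).trans
      (by rwa [Matrix.frobenius_norm_transpose])
  have hEA : ‖Eᵀ * A‖ ≤ ‖D‖ * B := by
    refine (Matrix.frobenius_norm_mul _ _).trans ?_
    rw [Matrix.frobenius_norm_transpose]
    exact mul_le_mul hED hA (norm_nonneg _) (norm_nonneg _)
  have h4 : ‖Vᵀ * A‖ ^ 2 - 2 * B ^ 2 * ‖D‖ ≤ ‖Vᵀ * A - Eᵀ * A‖ ^ 2 := by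
    rw [frobenius_norm_sq_sub]
    have h5 := trace_transpose_mul_le (Vᵀ * A) (Eᵀ * A)
    have h6 : ‖Vᵀ * A‖ * ‖Eᵀ * A‖ ≤ B * (‖D‖ * B) := mul_le_mul hVA hEA (norm_nonneg _) hB
    nlinarith [sq_nonneg ‖Eᵀ * A‖]
  rw [frobenius_norm_sq_projection_sub h.1 hV]
  have h7 := mul_le_mul_of_nonneg_left h3 hρ
  linarith

/-! ### Iterates of a run and the ascent of the two objectives -/

theorem next_eq_update {I r : Fin K → ℕ} (A : ℕ → Factors I r) (t : ℕ) (k : Fin K) :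
    next A t k = Function.update (curr A t k) k (A (t + 1) k) := by
  ext1 q
  rcases eq_or_ne q k with rfl | h
  · simp [next]
  · rw [Function.update_of_ne h]
    simp only [next, curr, le_iff_lt_or_eq, h, or_false]

theorem update_curr_self {I r : Fin K → ℕ} (A : ℕ → Factors I r) (t : ℕ) (k : Fin K) :
    Function.update (curr A t k) k (A t k) = curr A t k := by
  refine Function.update_eq_self_iff.mpr ?_
  simp [curr]

/-- The changes of a function of all factors during the updates of one iteration telescope. -/
theorem sum_next_sub_curr {I r : Fin K → ℕ} (A : ℕ → Factors I r) (t : ℕ) (φ : Factors I r → ℝ) :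
    ∑ k, (φ (next A t k) - φ (curr A t k)) = φ (A (t + 1)) - φ (A t) := by
  -- `G m` is the value once the first `m` modes are updated, so one mode's update ends where the
  -- next begins.
  set G : ℕ → ℝ := fun m => φ fun q : Fin K => if (q : ℕ) < m then A (t + 1) q else A t q with hG
  have h : ∀ k : Fin K, φ (next A t k) - φ (curr A t k) = G (k + 1) - G k := fun k => by
    have h1 : next A t k = fun q : Fin K => if (q : ℕ) < k + 1 then A (t + 1) q else A t q := by
      ext1 q
      simp only [next, Fin.le_def, Nat.lt_succ_iff]
    have h2 : curr A t k = fun q : Fin K => if (q : ℕ) < k then A (t + 1) q else A t q := rfl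
    rw [h1, h2]
  rw [Finset.sum_congr rfl fun k _ => h k, Fin.sum_univ_eq_sum_range (fun m => G (m + 1) - G m) K,
    Finset.sum_range_sub]
  simp [hG]

variable {N : ℕ} {I g : Fin K → ℕ} {s : Fin N → ℕ} {l : Fin N → Fin K → ℕ}
  {𝒦 : Finset (Fin K)} {Y : ∀ n, Tensor I (s n)} {B ρ : ℝ} {C₀ : ∀ n, Tensor (l n) (s n)}
  {U : ℕ → Factors I g} {V : ∀ n, ℕ → Factors I (l n)}

theorem IsRun.global_orthonormal (h : IsRun 𝒦 Y ρ C₀ U V) {t : ℕ} (ht : 1 ≤ t) (k : Fin K) :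
    (U t k)ᵀ * U t k = 1 := by
  obtain ⟨t, rfl⟩ := Nat.exists_eq_add_of_le' ht
  exact (h.global_update t k).1

theorem IsRun.local_orthonormal (h : IsRun 𝒦 Y ρ C₀ U V) {t : ℕ} (ht : 1 ≤ t) (n : Fin N)
    (k : Fin K) : (V n t k)ᵀ * V n t k = 1 := by
  obtain ⟨t, rfl⟩ := Nat.exists_eq_add_of_le' ht
  by_cases hk : k ∈ 𝒦
  · exact (h.local_update_of_mem t n k hk).1.1
  · exact (h.local_update_of_notMem t n k hk).1

theorem IsRun.global_transpose_mul_local (h : IsRun 𝒦 Y ρ C₀ U V) {t : ℕ} (ht : 1 ≤ t) (n : Fin N)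
    {k : Fin K} (hk : k ∈ 𝒦) : (U t k)ᵀ * V n t k = 0 := by
  obtain ⟨t, rfl⟩ := Nat.exists_eq_add_of_le' ht
  exact (h.local_update_of_mem t n k hk).2

theorem curr_orthonormal {r : Fin K → ℕ} {A : ℕ → Factors I r}
    (hA : ∀ t, 1 ≤ t → ∀ k, (A t k)ᵀ * A t k = 1) {t : ℕ} (ht : 1 ≤ t) (k q : Fin K) :
    (curr A t k q)ᵀ * curr A t k q = 1 := by
  rw [curr]
  split_ifs
  · exact hA _ (by lia) q
  · exact hA _ ht q

theorem next_orthonormal {r : Fin K → ℕ} {A : ℕ → Factors I r}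
    (hA : ∀ t, 1 ≤ t → ∀ k, (A t k)ᵀ * A t k = 1) {t : ℕ} (ht : 1 ≤ t) (k q : Fin K) :
    (next A t k q)ᵀ * next A t k q = 1 := by
  rw [next]
  split_ifs
  · exact hA _ (by lia) q
  · exact hA _ ht q

/-- In a mode other than `k` both families carry the same time index, so their orthogonality
survives the middle of an iteration. -/
theorem update_curr_transpose_mul {r r' : Fin K → ℕ} {A : ℕ → Factors I r} {A' : ℕ → Factors I r'}
    {k q : Fin K} (hq : ∀ t, 1 ≤ t → (A t q)ᵀ * A' t q = 0) (hqk : q ≠ k) {t : ℕ} (ht : 1 ≤ t)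
    (X : Matrix (Fin (I k)) (Fin (r k)) ℝ) (X' : Matrix (Fin (I k)) (Fin (r' k)) ℝ) :
    (Function.update (curr A t k) k X q)ᵀ * Function.update (curr A' t k) k X' q = 0 := by
  rw [Function.update_of_ne hqk, Function.update_of_ne hqk]
  simp only [curr]
  split_ifs
  · exact hq _ (by lia)
  · exact hq _ ht

/-- A mode of `𝒦` other than `k` removes the local part whatever its core is. -/
theorem IsRun.norm_transpose_mul_W_globalResidual (h : IsRun 𝒦 Y ρ C₀ U V) (h𝒦 : 2 ≤ 𝒦.card)
    {t : ℕ} (ht : 1 ≤ t) (n : Fin N) (k : Fin K) (X : Matrix (Fin (I k)) (Fin (g k)) ℝ) :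
    ‖Xᵀ * W k (globalResidual (Y n) (C₀ n) (V n) t k) (curr U t k)‖ =
      ‖core (Y n) (Function.update (curr U t k) k X)‖ := by
  obtain ⟨q, hq, hqk⟩ := Finset.exists_mem_ne h𝒦 k
  rw [norm_transpose_mul_W, globalResidual]
  refine congrArg norm (core_sub_tuckerProd _ _ _ _ (q := q) ?_)
  have := update_curr_transpose_mul (A := U) (A' := V n)
    (fun t ht => h.global_transpose_mul_local ht n hq) hqk ht X (V n t k)
  rwa [update_curr_self] at this

theorem IsRun.norm_transpose_mul_W_localResidual (h : IsRun 𝒦 Y ρ C₀ U V) (h𝒦 : 2 ≤ 𝒦.card)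
    {t : ℕ} (ht : 1 ≤ t) (n : Fin N) (k : Fin K) (X : Matrix (Fin (I k)) (Fin (l n k)) ℝ) :
    ‖Xᵀ * W k (localResidual (Y n) U t k) (curr (V n) t k)‖ =
      ‖core (Y n) (Function.update (curr (V n) t k) k X)‖ := by
  obtain ⟨q, hq, hqk⟩ := Finset.exists_mem_ne h𝒦 k
  rw [norm_transpose_mul_W, localResidual]
  refine congrArg norm (core_sub_tuckerProd _ _ _ _ (q := q) ?_)
  rw [next_eq_update]
  refine update_curr_transpose_mul (A := V n) (A' := U) (fun t ht => ?_) hqk ht X _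
  have := congrArg Matrix.transpose (h.global_transpose_mul_local ht n hq)
  simpa [Matrix.transpose_mul] using this

theorem IsRun.global_step (h : IsRun 𝒦 Y ρ C₀ U V) (h𝒦 : 2 ≤ 𝒦.card) {t : ℕ} (ht : 1 ≤ t)
    (k : Fin K) :
    ρ * ‖U (t + 1) k * (U (t + 1) k)ᵀ - U t k * (U t k)ᵀ‖ ^ 2 ≤
      ∑ n, ‖core (Y n) (next U t k)‖ ^ 2 - ∑ n, ‖core (Y n) (curr U t k)‖ ^ 2 := by
  have h1 := (h.global_update t k).proximal_le
    (by simp [Matrix.transpose_sum, Matrix.transpose_mul]) (h.global_orthonormal ht k)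
  have h2 : ∀ X : Matrix (Fin (I k)) (Fin (g k)) ℝ,
      (Xᵀ * (∑ n, W k (globalResidual (Y n) (C₀ n) (V n) t k) (curr U t k) *
        (W k (globalResidual (Y n) (C₀ n) (V n) t k) (curr U t k))ᵀ) * X).trace =
      ∑ n, ‖core (Y n) (Function.update (curr U t k) k X)‖ ^ 2 := fun X => by
    rw [Matrix.mul_sum, Matrix.sum_mul, Matrix.trace_sum]
    refine Finset.sum_congr rfl fun n _ => ?_
    rw [← h.norm_transpose_mul_W_globalResidual h𝒦 ht, frobenius_norm_sq_transpose_mul]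
  rwa [h2, h2, update_curr_self, ← next_eq_update] at h1

theorem IsRun.local_step (h : IsRun 𝒦 Y ρ C₀ U V) (h𝒦 : 2 ≤ 𝒦.card) (hY : ∀ n, ‖Y n‖ ≤ B)
    (hρ : 0 ≤ ρ) {t : ℕ} (ht : 1 ≤ t) (n : Fin N) (k : Fin K) :
    ρ * ‖V n (t + 1) k * (V n (t + 1) k)ᵀ - V n t k * (V n t k)ᵀ‖ ^ 2 ≤
      ‖core (Y n) (next (V n) t k)‖ ^ 2 - ‖core (Y n) (curr (V n) t k)‖ ^ 2 +
      (2 * B ^ 2 * ‖U (t + 1) k * (U (t + 1) k)ᵀ - U t k * (U t k)ᵀ‖ +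
        4 * ρ * ‖U (t + 1) k * (U (t + 1) k)ᵀ - U t k * (U t k)ᵀ‖ ^ 2) := by
  have hU : ∀ t, 1 ≤ t → ∀ k, (U t k)ᵀ * U t k = 1 := fun t ht => h.global_orthonormal ht
  have hV : ∀ t, 1 ≤ t → ∀ k, (V n t k)ᵀ * V n t k = 1 := fun t ht => h.local_orthonormal ht n
  have e1 := h.norm_transpose_mul_W_localResidual h𝒦 ht n k (V n (t + 1) k)
  have e2 := h.norm_transpose_mul_W_localResidual h𝒦 ht n k (V n t k)
  rw [← next_eq_update] at e1
  rw [update_curr_self] at e2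
  rw [← e1, ← e2]
  by_cases hk : k ∈ 𝒦
  · obtain ⟨h1, h2⟩ := h.local_update_of_mem t n k hk
    refine h1.projected_proximal_le hρ ?_ (hV t ht k) (hU (t + 1) (by lia) k)
      (h.global_transpose_mul_local ht n hk) h2
    exact (norm_W_le k _ (curr_orthonormal hV ht k)).trans
      ((norm_sub_tuckerProd_core_le _ (next_orthonormal hU ht k)).trans (hY n))
  · have h1 := (h.local_update_of_notMem t n k hk).proximal_le
      (by simp [Matrix.transpose_mul]) (hV t ht k)
    rw [← frobenius_norm_sq_transpose_mul, ← frobenius_norm_sq_transpose_mul] at h1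
    -- Outside `𝒦` nothing is projected, and the error term is merely added.
    exact h1.trans (le_add_of_nonneg_right (by positivity))

theorem subspaceChange_nonneg {r : Fin K → ℕ} (A : ℕ → Factors I r) (t : ℕ) :
    0 ≤ subspaceChange A t :=
  Finset.sum_nonneg fun _ _ => sq_nonneg _

theorem norm_le_sqrt_subspaceChange {r : Fin K → ℕ} (A : ℕ → Factors I r) (t : ℕ) (k : Fin K) :
    ‖A (t + 1) k * (A (t + 1) k)ᵀ - A t k * (A t k)ᵀ‖ ≤ √(subspaceChange A t) :=
  Real.le_sqrt_of_sq_le <| Finset.single_le_sum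
    (f := fun k => ‖A (t + 1) k * (A (t + 1) k)ᵀ - A t k * (A t k)ᵀ‖ ^ 2)
    (fun _ _ => sq_nonneg _) (Finset.mem_univ k)

theorem IsRun.global_iteration (h : IsRun 𝒦 Y ρ C₀ U V) (h𝒦 : 2 ≤ 𝒦.card) {t : ℕ}
    (ht : 1 ≤ t) : ρ * subspaceChange U t ≤
      ∑ n, ‖core (Y n) (U (t + 1))‖ ^ 2 - ∑ n, ‖core (Y n) (U t)‖ ^ 2 := by
  rw [← sum_next_sub_curr U t fun A => ∑ n, ‖core (Y n) A‖ ^ 2, subspaceChange, Finset.mul_sum]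
  exact Finset.sum_le_sum fun k _ => h.global_step h𝒦 ht k

theorem IsRun.local_iteration (h : IsRun 𝒦 Y ρ C₀ U V) (h𝒦 : 2 ≤ 𝒦.card) (hY : ∀ n, ‖Y n‖ ≤ B)
    (hρ : 0 ≤ ρ) {t : ℕ} (ht : 1 ≤ t) (n : Fin N) : ρ * subspaceChange (V n) t ≤
      ‖core (Y n) (V n (t + 1))‖ ^ 2 - ‖core (Y n) (V n t)‖ ^ 2 +
      (2 * B ^ 2 * (K * √(subspaceChange U t)) + 4 * ρ * subspaceChange U t) := by
  have h1 : ∑ k, ‖U (t + 1) k * (U (t + 1) k)ᵀ - U t k * (U t k)ᵀ‖ ≤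
      K * √(subspaceChange U t) := by
    refine (Finset.sum_le_sum fun k _ => norm_le_sqrt_subspaceChange U t k).trans ?_
    simp
  have h2 := Finset.sum_le_sum fun k (_ : k ∈ Finset.univ) => h.local_step h𝒦 hY hρ ht n k
  rw [← Finset.mul_sum, Finset.sum_add_distrib, Finset.sum_add_distrib, ← Finset.mul_sum,
    ← Finset.mul_sum, sum_next_sub_curr (V n) t fun A => ‖core (Y n) A‖ ^ 2] at h2
  change ρ * subspaceChange (V n) t ≤ _ + (_ + 4 * ρ * subspaceChange U t) at h2
  have h3 := mul_le_mul_of_nonneg_left h1 (by positivity : 0 ≤ 2 * B ^ 2)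
  linarith

/-! ### Summation over the iterations -/

theorem sum_Icc_sub (f : ℕ → ℝ) (T : ℕ) :
    ∑ t ∈ Finset.Icc 1 T, (f (t + 1) - f t) = f (T + 1) - f 1 := by
  induction T with
  | zero => simp
  | succ T ih => rw [Finset.sum_Icc_succ_top (by lia), ih]; ring

theorem inf'_le_div_of_sum_le {T : ℕ} (hT : 1 ≤ T) {f : ℕ → ℝ} {c : ℝ}
    (h : ∑ t ∈ Finset.Icc 1 T, f t ≤ c) :
    (Finset.Icc 1 T).inf' (Finset.nonempty_Icc.mpr hT) f ≤ c / T := by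
  have hT' : (0 : ℝ) < T := by exact_mod_cast hT
  rw [le_div_iff₀' hT']
  have := Finset.card_nsmul_le_sum (Finset.Icc 1 T) f
    ((Finset.Icc 1 T).inf' (Finset.nonempty_Icc.mpr hT) f) fun t ht => Finset.inf'_le f ht
  rw [Nat.card_Icc, Nat.add_sub_cancel, nsmul_eq_mul] at this
  exact this.trans h

theorem sum_sq_norm_core_le {r : Fin N → Fin K → ℕ} {A : ∀ n, Factors I (r n)}
    (hY : ∀ n, ‖Y n‖ ≤ B) (hA : ∀ n k, (A n k)ᵀ * A n k = 1) :
    ∑ n, ‖core (Y n) (A n)‖ ^ 2 ≤ N * B ^ 2 := by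
  refine (Finset.sum_le_sum fun n _ =>
    pow_le_pow_left₀ (norm_nonneg _) ((norm_core_le _ (hA n)).trans (hY n)) 2).trans ?_
  simp

/-- The sum starts at `t = 1` because the arbitrary initial factors need be neither orthonormal nor
mutually orthogonal. -/
theorem IsRun.sum_global_change_le (h : IsRun 𝒦 Y ρ C₀ U V) (h𝒦 : 2 ≤ 𝒦.card)
    (hY : ∀ n, ‖Y n‖ ≤ B) (T : ℕ) :
    ρ * ∑ t ∈ Finset.Icc 1 T, subspaceChange U t ≤ N * B ^ 2 := by
  rw [Finset.mul_sum]
  refine (Finset.sum_le_sum fun t ht => h.global_iteration h𝒦 (Finset.mem_Icc.mp ht).1).trans ?_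
  rw [sum_Icc_sub fun t => ∑ n, ‖core (Y n) (U t)‖ ^ 2]
  have h1 := sum_sq_norm_core_le (A := fun _ => U (T + 1)) hY
    fun _ => h.global_orthonormal (by lia)
  have h2 : 0 ≤ ∑ n, ‖core (Y n) (U 1)‖ ^ 2 := Finset.sum_nonneg fun _ _ => sq_nonneg _
  linarith

theorem IsRun.sum_local_change_le (h : IsRun 𝒦 Y ρ C₀ U V) (h𝒦 : 2 ≤ 𝒦.card)
    (hY : ∀ n, ‖Y n‖ ≤ B) (hρ : 0 ≤ ρ) (T : ℕ) :
    ρ * ∑ t ∈ Finset.Icc 1 T, ∑ n, subspaceChange (V n) t ≤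
      N * B ^ 2 + N * (2 * B ^ 2 * (K * ∑ t ∈ Finset.Icc 1 T, √(subspaceChange U t)) +
        4 * ρ * ∑ t ∈ Finset.Icc 1 T, subspaceChange U t) := by
  have h0 : ∀ t ∈ Finset.Icc 1 T, ρ * ∑ n, subspaceChange (V n) t ≤
      (∑ n, ‖core (Y n) (V n (t + 1))‖ ^ 2 - ∑ n, ‖core (Y n) (V n t)‖ ^ 2) +
      N * (2 * B ^ 2 * (K * √(subspaceChange U t)) + 4 * ρ * subspaceChange U t) := by
    intro t ht
    rw [Finset.mul_sum]
    refine (Finset.sum_le_sum fun n _ =>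
      h.local_iteration h𝒦 hY hρ (Finset.mem_Icc.mp ht).1 n).trans ?_
    rw [Finset.sum_add_distrib, Finset.sum_sub_distrib]
    simp [mul_add]
  rw [Finset.mul_sum]
  refine (Finset.sum_le_sum h0).trans ?_
  rw [Finset.sum_add_distrib, sum_Icc_sub fun t => ∑ n, ‖core (Y n) (V n t)‖ ^ 2,
    ← Finset.mul_sum, Finset.sum_add_distrib, ← Finset.mul_sum, ← Finset.mul_sum, ← Finset.mul_sum]
  have h1 := sum_sq_norm_core_le (A := fun n => V n (T + 1)) hY
    fun n => h.local_orthonormal (by lia) n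
  have h2 : 0 ≤ ∑ n, ‖core (Y n) (V n 1)‖ ^ 2 := Finset.sum_nonneg fun _ _ => sq_nonneg _
  linarith

/-- Cauchy–Schwarz against the constant 1; this is where the local rate drops to `1/√T`. -/
theorem sum_sqrt_le {T : ℕ} {f : ℕ → ℝ} (hf : ∀ t, 0 ≤ f t)
    (h : ∑ t ∈ Finset.Icc 1 T, f t ≤ 1) : ∑ t ∈ Finset.Icc 1 T, √(f t) ≤ √T := by
  have h1 := Real.sum_sqrt_mul_sqrt_le (Finset.Icc 1 T) hf (g := fun _ => 1) fun _ => zero_le_one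
  simp only [Real.sqrt_one, mul_one, Finset.sum_const, Nat.card_Icc, Nat.add_sub_cancel,
    nsmul_eq_mul] at h1
  exact h1.trans (mul_le_of_le_one_left (Real.sqrt_nonneg _) (Real.sqrt_le_one.mpr h))

end PerTucker

/-! ### The convergence rates -/

theorem theorem1 (N K : ℕ) (hN : 1 ≤ N) :
    ∃ C : ℝ, 0 < C ∧
      ∀ (I g : Fin K → ℕ) (s : Fin N → ℕ) (l : Fin N → Fin K → ℕ) (𝒦 : Finset (Fin K))
        (Y : ∀ n, PerTucker.Tensor I (s n)) (B ρ : ℝ)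
        (C₀ : ∀ n, PerTucker.Tensor (l n) (s n))
        (U : ℕ → PerTucker.Factors I g) (V : ∀ n, ℕ → PerTucker.Factors I (l n)),
        2 ≤ 𝒦.card → 0 < B → (∀ n, ‖Y n‖ ≤ B) → 8 * B ^ 2 * (N : ℝ) ≤ ρ →
        PerTucker.IsRun 𝒦 Y ρ C₀ U V →
        ∀ (T : ℕ) (hT : 1 ≤ T),
          (Finset.Icc 1 T).inf' (Finset.nonempty_Icc.mpr hT)
              (fun t => PerTucker.subspaceChange U t) ≤ C / (T : ℝ) ∧
          (Finset.Icc 1 T).inf' (Finset.nonempty_Icc.mpr hT)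
              (fun t => ∑ n, PerTucker.subspaceChange (V n) t) ≤ C / Real.sqrt (T : ℝ) := by
  -- After division by `ρ ≥ 8 B² N`, the local bound is at most `1/8 + (K/4) √T + N/2`: objective
  -- range, linear errors, quadratic errors. The constant is a generous majorant of the
  -- coefficients.
  refine ⟨1 + K + N, by positivity, ?_⟩
  intro I g s l 𝒦 Y B ρ C₀ U V h𝒦 hB hY hρB h T hT
  have hN' : (1 : ℝ) ≤ N := by exact_mod_cast hN
  have hK : (0 : ℝ) ≤ K := K.cast_nonneg
  have hT' : (1 : ℝ) ≤ T := by exact_mod_cast hT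
  have hBN : 0 < B ^ 2 * N := by positivity
  have hρ : 0 < ρ := by linarith
  have hU : ∑ t ∈ Finset.Icc 1 T, PerTucker.subspaceChange U t ≤ 1 / 8 := by
    have := h.sum_global_change_le h𝒦 hY T
    nlinarith
  refine ⟨PerTucker.inf'_le_div_of_sum_le hT (by linarith), ?_⟩
  have hsqrt : 1 ≤ √(T : ℝ) := Real.one_le_sqrt.mpr hT'
  have hV : ∑ t ∈ Finset.Icc 1 T, ∑ n, PerTucker.subspaceChange (V n) t ≤
      (1 + K + N) * √(T : ℝ) := by
    have h1 := h.sum_local_change_le h𝒦 hY hρ.le T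
    have h2 := PerTucker.sum_sqrt_le (T := T) (PerTucker.subspaceChange_nonneg U) (by linarith)
    refine le_of_mul_le_mul_left (h1.trans ?_) hρ
    have h3 : B ^ 2 * N * (K * ∑ t ∈ Finset.Icc 1 T, √(PerTucker.subspaceChange U t)) ≤
        ρ / 8 * (K * √(T : ℝ)) := by
      gcongr
      linarith
    have h4 : ρ * N * ∑ t ∈ Finset.Icc 1 T, PerTucker.subspaceChange U t ≤ ρ * N * (1 / 8) := by
      gcongr
    have h5 : ρ * (1 + N) ≤ ρ * (1 + N) * √(T : ℝ) := le_mul_of_one_le_right (by positivity) hsqrt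
    have h6 : 0 ≤ ρ * (K * √(T : ℝ)) := by positivity
    have h7 : 0 ≤ ρ * N := by positivity
    nlinarith
  refine (PerTucker.inf'_le_div_of_sum_le hT hV).trans_eq ?_
  rw [mul_div_assoc, Real.sqrt_div_self', mul_one_div]
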